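/- Let $L^2[0,1]$ be the space of real-valued square-integrable functions on $[0,1]$ (with respect to Lebesgue measure, functions equal a.e. being identified), with the norm $\|\cdot\|_2$. Let $\Gamma$ be the set of all absolutely continuous functions $\gamma:[0,1]\to[0,1]$ with $\gamma(0)=0$, $\gamma(1)=1$ and $\dot\gamma\ge 0$ a.e. on $[0,1]$, and let $\Gamma_0=\{\gamma\in\Gamma : \dot\gamma>0 \text{ a.e. on } [0,1]\}$. For $q\in L^2[0,1]$ and $\gamma\in\Gamma$ put $(q,\gamma)=(q\circ\gamma)\sqrt{\dot\gamma}$ (defined a.e. on $[0,1]$), and let $$[q]_\Gamma=\{\overline q : \overline q=(q,\gamma)\text{ a.e. on }[0,1]\text{ for some }\gamma\in\Gamma\},\qquad [q]_{\Gamma_0}=\{\overline q : \overline q=(q,\gamma)\text{ a.e. on }[0,1]\text{ for some }\gamma\in\Gamma_0\}.$$ **Proposition 4.13.** For every $q\in L^2[0,1]$, every $(q,\gamma)$ with $\gamma\in\Gamma$ belongs to $L^2[0,1]$, and $[q]_\Gamma\subseteq cl([q]_{\Gamma_0})$, where $cl$ denotes the closure in $L^2[0,1]$. -/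

import Mathlib

open MeasureTheory

/-- Lebesgue measure on the unit interval `[0,1]`, as a measure on `ℝ`. -/
noncomputable abbrev unitMeasure : Measure ℝ := volume.restrict (Set.Icc (0 : ℝ) 1)

/-- The Hilbert space `L²[0,1]` of real functions modulo equality almost everywhere. -/
abbrev L2Unit : Type := Lp ℝ 2 unitMeasure

/-- The admissible class `Γ` of warping functions `γ : [0,1] → [0,1]`: absolutely continuous,
with `γ' ≥ 0` almost everywhere, `γ 0 = 0` and `γ 1 = 1`. A warping function is represented by
a function `ℝ → ℝ`; only its values on `[0,1]` matter, here and in `warp`. -/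
def warpings : Set (ℝ → ℝ) :=
  {γ | Set.MapsTo γ (Set.Icc 0 1) (Set.Icc 0 1) ∧
    AbsolutelyContinuousOnInterval γ 0 1 ∧
    (∀ᵐ t ∂unitMeasure, 0 ≤ deriv γ t) ∧
    γ 0 = 0 ∧ γ 1 = 1}

/-- The group `Γ₀` of invertible warping functions: those with `γ' > 0` almost everywhere. -/
def invertibleWarpings : Set (ℝ → ℝ) :=
  {γ | γ ∈ warpings ∧ ∀ᵐ t ∂unitMeasure, 0 < deriv γ t}

/-- The warped function `(q, γ) = (q ∘ γ) √γ'`. -/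
noncomputable def warp (q γ : ℝ → ℝ) : ℝ → ℝ :=
  fun t => q (γ t) * Real.sqrt (deriv γ t)

/-- The orbit of `q` under a set `G` of warping functions: all elements of `L²[0,1]` that are
almost everywhere equal to `(q, γ)` for some `γ ∈ G`. -/
def warpOrbit (G : Set (ℝ → ℝ)) (q : ℝ → ℝ) : Set L2Unit :=
  {p | ∃ γ ∈ G, p =ᵐ[unitMeasure] warp q γ}

open Set Filter Topology
open scoped ENNReal

namespace warpings

variable {γ : ℝ → ℝ}

/-! For each `γ ∈ warpings`, invertible or not, `q ↦ warp q γ` is linear, and the change of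
variables `∫ γ' · (u ∘ γ) = ∫ u` makes it norm preserving on `L²`. The convex combinations `(1 - s)
γ + s · id` with `0 < s ≤ 1` have derivative at least `s` a.e., so they are invertible warpings. As
`s → 0`, dominated convergence handles bounded continuous `p`. Such `p` are dense, and norm
preservation makes the error of replacing `q` by `p` the same for every warping, so an `ε / 3`
argument concludes. -/

theorem intervalIntegrable_deriv (hγ : γ ∈ warpings) :
    IntervalIntegrable (deriv γ) volume 0 1 :=
  hγ.2.1.intervalIntegrable_deriv

theorem integrable_deriv (hγ : γ ∈ warpings) : Integrable (deriv γ) unitMeasure := by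
  have h := (intervalIntegrable_iff_integrableOn_Icc_of_le zero_le_one).1
    (intervalIntegrable_deriv hγ)
  exact h

theorem integral_deriv (hγ : γ ∈ warpings) : ∫ t, deriv γ t ∂unitMeasure = 1 := by
  have h := hγ.2.1.integral_deriv_eq_sub
  rw [intervalIntegral.integral_of_le zero_le_one, ← integral_Icc_eq_integral_Ioc,
    hγ.2.2.2.1, hγ.2.2.2.2] at h
  simpa using h

theorem lintegral_deriv (hγ : γ ∈ warpings) :
    ∫⁻ t, ENNReal.ofReal (deriv γ t) ∂unitMeasure = 1 := by
  rw [← ofReal_integral_eq_lintegral_ofReal (integrable_deriv hγ) hγ.2.2.1, integral_deriv hγ,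
    ENNReal.ofReal_one]

theorem monotoneOn (hγ : γ ∈ warpings) : MonotoneOn γ (Icc 0 1) := by
  intro x hx y hy hxy
  have hac : AbsolutelyContinuousOnInterval γ x y := hγ.2.1.mono (by
    rw [uIcc_of_le hxy, uIcc_of_le zero_le_one]
    exact Icc_subset_Icc hx.1 hy.2)
  rw [← sub_nonneg, ← hac.integral_deriv_eq_sub]
  refine intervalIntegral.integral_nonneg_of_ae_restrict hxy ?_
  exact ae_restrict_of_ae_restrict_of_subset (Icc_subset_Icc hx.1 hy.2) hγ.2.2.1

theorem ae_differentiableAt (hγ : γ ∈ warpings) :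
    ∀ᵐ t ∂unitMeasure, DifferentiableAt ℝ γ t := by
  rw [ae_restrict_iff' measurableSet_Icc]
  simpa [uIcc_of_le] using hγ.2.1.ae_differentiableAt

theorem aemeasurable (hγ : γ ∈ warpings) : AEMeasurable γ unitMeasure := by
  have h := hγ.2.1.continuousOn
  rw [uIcc_of_le zero_le_one] at h
  exact h.aemeasurable measurableSet_Icc

/-- Change of variables along a warping function; no measurability of `u` is needed. -/
theorem lintegral_comp_mul_deriv (hγ : γ ∈ warpings) (u : ℝ → ℝ≥0∞) :
    ∫⁻ t, ENNReal.ofReal (deriv γ t) * u (γ t) ∂unitMeasure = ∫⁻ x, u x ∂unitMeasure := by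
  set s : Set ℝ := Icc 0 1 ∩ {t | DifferentiableAt ℝ γ t} with hs
  have hsm : MeasurableSet s := measurableSet_Icc.inter (measurableSet_of_differentiableAt ℝ γ)
  have hsub : s ⊆ Icc 0 1 := inter_subset_left
  have hres : (volume.restrict s : Measure ℝ) = unitMeasure := by
    refine Measure.restrict_congr_set ?_
    have := (ae_restrict_iff' measurableSet_Icc).1 (ae_differentiableAt hγ)
    filter_upwards [this] with t ht
    exact propext ⟨fun h => h.1, fun h => ⟨h, ht h⟩⟩
  have hd : ∀ x ∈ s, HasDerivWithinAt γ (deriv γ x) s x :=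
    fun x hx => hx.2.hasDerivAt.hasDerivWithinAt
  have hm : MonotoneOn γ s := (monotoneOn hγ).mono hsub
  have himg : γ '' s ⊆ Icc 0 1 := (image_mono hsub).trans hγ.1.image_subset
  have himgm : MeasurableSet (γ '' s) := hsm.image_of_monotoneOn hm
  -- Absolute continuity gives `∫ γ' = 1`, so the image of the differentiability set fills `[0,1]`
  -- up to a null set.
  have hvol : volume (γ '' s) = 1 := by
    rw [← lintegral_deriv_eq_volume_image_of_monotoneOn hsm hd hm, hres, lintegral_deriv hγ]
  have hae : (γ '' s : Set ℝ) =ᵐ[volume] Icc (0 : ℝ) 1 :=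
    ae_eq_of_subset_of_measure_ge himg (by simp [hvol]) himgm.nullMeasurableSet (by simp)
  have h := lintegral_image_eq_lintegral_deriv_mul_of_monotoneOn hsm hd hm u
  rw [hres, Measure.restrict_congr_set hae] at h
  exact h.symm

/-- A flat piece of `γ` can send a set of positive measure into a null set. The change of variables,
applied to the indicator of a measurable null set containing the exceptions, forces `γ' = 0` a.e. on
its preimage. -/
theorem ae_deriv_eq_zero_or_comp (hγ : γ ∈ warpings) {P : ℝ → Prop}
    (hP : ∀ᵐ x ∂unitMeasure, P x) :
    ∀ᵐ t ∂unitMeasure, deriv γ t = 0 ∨ P (γ t) := by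
  set M := toMeasurable unitMeasure {x | ¬ P x}
  have hM : MeasurableSet M := measurableSet_toMeasurable _ _
  have hM0 : unitMeasure M = 0 := by rw [measure_toMeasurable]; exact hP
  have h := lintegral_comp_mul_deriv hγ (M.indicator 1)
  rw [lintegral_indicator_one hM, hM0, lintegral_eq_zero_iff'] at h
  · filter_upwards [h, hγ.2.2.1] with t ht ht0
    by_contra! hc
    have hmem : γ t ∈ M := subset_toMeasurable _ _ hc.2
    have hpos : 0 < deriv γ t := lt_of_le_of_ne ht0 hc.1.symm
    simp [hmem] at ht
    linarith
  · exact (measurable_deriv γ).ennreal_ofReal.aemeasurable.mul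
      ((measurable_one.indicator hM).comp_aemeasurable (aemeasurable hγ))

end warpings

theorem warp_sub (p q γ : ℝ → ℝ) : warp p γ - warp q γ = warp (p - q) γ := by
  ext t
  simp [warp, sub_mul]

theorem eLpNorm_two_eq {f : ℝ → ℝ} {μ : Measure ℝ} :
    eLpNorm f 2 μ = (∫⁻ t, ‖f t‖ₑ ^ 2 ∂μ) ^ (1 / 2 : ℝ) := by
  rw [eLpNorm_eq_lintegral_rpow_enorm_toReal (by norm_num) (by norm_num)]
  simp

theorem enorm_warp_sq (q γ : ℝ → ℝ) (t : ℝ) :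
    ‖warp q γ t‖ₑ ^ 2 = ENNReal.ofReal (deriv γ t) * ‖q (γ t)‖ₑ ^ 2 := by
  rw [warp, enorm_mul, mul_pow, mul_comm]
  congr 1
  rw [Real.enorm_of_nonneg (Real.sqrt_nonneg _), ← ENNReal.ofReal_pow (Real.sqrt_nonneg _)]
  -- For a negative derivative, `Real.sqrt` and `ENNReal.ofReal` both truncate to `0`.
  rcases le_total 0 (deriv γ t) with h | h
  · rw [Real.sq_sqrt h]
  · simp [Real.sqrt_eq_zero_of_nonpos h, ENNReal.ofReal_of_nonpos h]

/-- Warping is norm preserving. -/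
theorem eLpNorm_warp {γ : ℝ → ℝ} (hγ : γ ∈ warpings) (q : ℝ → ℝ) :
    eLpNorm (warp q γ) 2 unitMeasure = eLpNorm q 2 unitMeasure := by
  simp_rw [eLpNorm_two_eq, enorm_warp_sq]
  rw [warpings.lintegral_comp_mul_deriv hγ (fun x => ‖q x‖ₑ ^ 2)]

/-- Changing `q` on a null set may change `q ∘ γ` on a set of positive measure, but there the factor
`√γ'` vanishes a.e.; hence `q` may be replaced by a measurable representative. -/
theorem aestronglyMeasurable_warp {γ : ℝ → ℝ} (hγ : γ ∈ warpings) {q : ℝ → ℝ}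
    (hq : AEStronglyMeasurable q unitMeasure) :
    AEStronglyMeasurable (warp q γ) unitMeasure := by
  have h : warp q γ =ᵐ[unitMeasure] warp (hq.mk q) γ := by
    filter_upwards [warpings.ae_deriv_eq_zero_or_comp hγ hq.ae_eq_mk] with t ht
    rcases ht with ht | ht <;> simp [warp, ht]
  refine AEStronglyMeasurable.congr (AEMeasurable.aestronglyMeasurable ?_) h.symm
  exact (hq.stronglyMeasurable_mk.measurable.comp_aemeasurable (warpings.aemeasurable hγ)).mul
    (measurable_deriv γ).sqrt.aemeasurable

theorem memLp_warp {γ : ℝ → ℝ} (hγ : γ ∈ warpings) {q : ℝ → ℝ} (hq : MemLp q 2 unitMeasure) :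
    MemLp (warp q γ) 2 unitMeasure :=
  ⟨aestronglyMeasurable_warp hγ hq.1, by rw [eLpNorm_warp hγ]; exact hq.2⟩

/-- Convex combination of a warping function with the identity. -/
def relaxWarping (γ : ℝ → ℝ) (s t : ℝ) : ℝ := (1 - s) * γ t + s * t

theorem deriv_relaxWarping {γ : ℝ → ℝ} {t : ℝ} (h : DifferentiableAt ℝ γ t) (s : ℝ) :
    deriv (relaxWarping γ s) t = (1 - s) * deriv γ t + s := by
  have := (h.hasDerivAt.const_mul (1 - s)).add ((hasDerivAt_id t).const_mul s)
  simpa using! this.deriv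

theorem relaxWarping_mem {γ : ℝ → ℝ} (hγ : γ ∈ warpings) {s : ℝ} (h0 : 0 < s) (h1 : s ≤ 1) :
    relaxWarping γ s ∈ invertibleWarpings := by
  have hpos : ∀ᵐ t ∂unitMeasure, 0 < deriv (relaxWarping γ s) t := by
    filter_upwards [warpings.ae_differentiableAt hγ, hγ.2.2.1] with t ht ht0
    rw [deriv_relaxWarping ht]
    have := mul_nonneg (sub_nonneg.2 h1) ht0
    linarith
  refine ⟨⟨?_, ?_, hpos.mono fun _ h => h.le, ?_, ?_⟩, hpos⟩
  · intro t ht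
    exact convex_Icc (0 : ℝ) 1 (hγ.1 ht) ht (sub_nonneg.2 h1) h0.le (by ring)
  · refine (hγ.2.1.const_mul (1 - s)).add (AbsolutelyContinuousOnInterval.const_mul s ?_)
    exact (contDiff_id.contDiffOn : ContDiffOn ℝ 1 id _).absolutelyContinuousOnInterval
  · simp [relaxWarping, hγ.2.2.2.1]
  · simp [relaxWarping, hγ.2.2.2.2]

theorem tendsto_relaxWarping (γ : ℝ → ℝ) (t : ℝ) :
    Tendsto (fun s => relaxWarping γ s t) (𝓝 0) (𝓝 (γ t)) := by
  have : Continuous fun s => relaxWarping γ s t := by unfold relaxWarping; fun_prop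
  simpa [relaxWarping] using this.tendsto 0

/-- For bounded continuous `p`, warping `p` by relaxations of `γ` converges in `L²`. -/
theorem tendsto_eLpNorm_warp_relaxWarping {γ : ℝ → ℝ} (hγ : γ ∈ warpings)
    (p : BoundedContinuousFunction ℝ ℝ)
    {s : ℕ → ℝ} (hs0 : ∀ n, 0 < s n) (hs1 : ∀ n, s n ≤ 1) (hs : Tendsto s atTop (𝓝 0)) :
    Tendsto (fun n => eLpNorm (warp p (relaxWarping γ (s n)) - warp p γ) 2 unitMeasure)
      atTop (𝓝 0) := by
  have hp : AEStronglyMeasurable p unitMeasure := p.continuous.aestronglyMeasurable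
  have hmeas := aestronglyMeasurable_warp hγ hp
  simp_rw [eLpNorm_two_eq]
  have key : Tendsto
      (fun n => ∫⁻ t, ‖(warp p (relaxWarping γ (s n)) - warp p γ) t‖ₑ ^ 2 ∂unitMeasure)
      atTop (𝓝 (∫⁻ _, 0 ∂unitMeasure)) := by
    -- Both derivatives are at most `γ' + 1`, so each warp is bounded by `‖p‖ √(γ' + 1)`; squaring
    -- the sum of the two bounds gives the factor `4`.
    refine tendsto_lintegral_of_dominated_convergence'
      (fun t => ENNReal.ofReal (4 * ‖p‖ ^ 2 * (deriv γ t + 1))) ?_ ?_ ?_ ?_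
    · intro n
      exact ((aestronglyMeasurable_warp (relaxWarping_mem hγ (hs0 n) (hs1 n)).1 hp).sub
        hmeas).enorm.pow_const 2
    · intro n
      filter_upwards [warpings.ae_differentiableAt hγ, hγ.2.2.1] with t ht ht0
      rw [← ofReal_norm, ← ENNReal.ofReal_pow (norm_nonneg _)]
      refine ENNReal.ofReal_le_ofReal ?_
      have hr : 0 ≤ deriv γ t + 1 := by linarith
      have bound : ∀ x y : ℝ, y ≤ deriv γ t + 1 →
          ‖p x * √y‖ ≤ ‖p‖ * √(deriv γ t + 1) := fun x y hy => by
        rw [norm_mul, Real.norm_of_nonneg (Real.sqrt_nonneg _)]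
        gcongr
        exact p.norm_coe_le_norm x
      have hle : deriv (relaxWarping γ (s n)) t ≤ deriv γ t + 1 := by
        rw [deriv_relaxWarping ht]
        have := mul_nonneg (hs0 n).le ht0
        linarith [hs1 n]
      calc ‖(warp p (relaxWarping γ (s n)) - warp p γ) t‖ ^ 2
          ≤ (‖p‖ * √(deriv γ t + 1) + ‖p‖ * √(deriv γ t + 1)) ^ 2 := by
            gcongr
            exact (norm_sub_le _ _).trans
              (add_le_add (bound _ _ hle) (bound _ _ (by linarith)))
        _ = 4 * ‖p‖ ^ 2 * √(deriv γ t + 1) ^ 2 := by ring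
        _ = 4 * ‖p‖ ^ 2 * (deriv γ t + 1) := by rw [Real.sq_sqrt hr]
    · have hi : Integrable (fun t => 4 * ‖p‖ ^ 2 * (deriv γ t + 1)) unitMeasure :=
        ((warpings.integrable_deriv hγ).add (integrable_const 1)).const_mul _
      exact hi.lintegral_lt_top.ne
    · filter_upwards [warpings.ae_differentiableAt hγ] with t ht
      have h1 : Tendsto (fun s => warp p (relaxWarping γ s) t) (𝓝 0) (𝓝 (warp p γ t)) := by
        refine ((p.continuous.tendsto _).comp (tendsto_relaxWarping γ t)).mul
          ((Real.continuous_sqrt.tendsto _).comp ?_)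
        simp_rw [deriv_relaxWarping ht]
        have : Continuous fun s : ℝ => (1 - s) * deriv γ t + s := by fun_prop
        simpa using this.tendsto 0
      have h2 := ENNReal.Tendsto.pow (n := 2) ((h1.comp hs).sub_const (warp p γ t)).enorm
      simpa using! h2
  rw [lintegral_zero] at key
  simpa using key.ennrpow_const (1 / 2 : ℝ)

/-- Every warped `L²` function is approximated in `L²` by invertible warpings of it. -/
theorem exists_invertible_eLpNorm_warp_sub_le {γ : ℝ → ℝ} (hγ : γ ∈ warpings) {q : ℝ → ℝ}
    (hq : MemLp q 2 unitMeasure) {ε : ℝ≥0∞} (hε : ε ≠ 0) :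
    ∃ δ ∈ invertibleWarpings, eLpNorm (warp q δ - warp q γ) 2 unitMeasure ≤ ε := by
  have hε3 : ε / 3 ≠ 0 := by simp [hε]
  obtain ⟨p, hpq, hp⟩ := hq.exists_boundedContinuous_eLpNorm_sub_le (by norm_num) hε3
  have hs0 (n : ℕ) : (0 : ℝ) < 1 / (n + 1) := Nat.one_div_pos_of_nat
  have hs1 (n : ℕ) : (1 : ℝ) / (n + 1) ≤ 1 :=
    div_le_one_of_le₀ (by simp) (by positivity)
  have hlim := tendsto_eLpNorm_warp_relaxWarping hγ p hs0 hs1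
    tendsto_one_div_add_atTop_nhds_zero_nat
  obtain ⟨n, hlt⟩ := (hlim.eventually (gt_mem_nhds (pos_iff_ne_zero.2 hε3))).exists
  have hδ := relaxWarping_mem hγ (hs0 n) (hs1 n)
  refine ⟨_, hδ, ?_⟩
  set δ := relaxWarping γ (1 / (n + 1))
  -- By norm preservation both terms in `q - p` have norm `‖q - p‖₂`, whatever `δ` is.
  have hsplit : warp q δ - warp q γ =
      warp (q - p) δ + ((warp p δ - warp p γ) - warp (q - p) γ) := by
    rw [← warp_sub, ← warp_sub]
    abel
  have hqp := hq.sub hp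
  have m1 := memLp_warp hδ.1 hqp
  have m2 := (memLp_warp hδ.1 hp).sub (memLp_warp hγ hp)
  have m3 := memLp_warp hγ hqp
  rw [hsplit]
  calc _ ≤ eLpNorm (warp (q - p) δ) 2 unitMeasure +
        (eLpNorm (warp p δ - warp p γ) 2 unitMeasure + eLpNorm (warp (q - p) γ) 2 unitMeasure) :=
        (eLpNorm_add_le m1.1 (m2.1.sub m3.1) one_le_two).trans
          (by gcongr; exact eLpNorm_sub_le m2.1 m3.1 one_le_two)
    _ ≤ ε / 3 + (ε / 3 + ε / 3) := by
        rw [eLpNorm_warp hδ.1, eLpNorm_warp hγ]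
        gcongr
    _ = ε := by rw [← add_assoc, ENNReal.add_thirds]

theorem proposition4p13 (q : ℝ → ℝ) (hq : MemLp q 2 unitMeasure) :
    (∀ γ ∈ warpings, MemLp (warp q γ) 2 unitMeasure) ∧
      warpOrbit warpings q ⊆ closure (warpOrbit invertibleWarpings q) := by
  refine ⟨fun γ hγ => memLp_warp hγ hq, ?_⟩
  rintro f ⟨γ, hγ, hf⟩
  refine EMetric.mem_closure_iff.2 fun ε hε => ?_
  -- The approximation gives only `≤`, while the closure criterion needs `<`.
  obtain ⟨η, hη0, hηε⟩ := exists_between hε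
  obtain ⟨δ, hδ, hle⟩ := exists_invertible_eLpNorm_warp_sub_le hγ hq hη0.ne'
  have hm := memLp_warp hδ.1 hq
  refine ⟨hm.toLp _, ⟨δ, hδ, hm.coeFn_toLp⟩, ?_⟩
  rw [edist_comm, Lp.edist_def]
  refine lt_of_le_of_lt (le_of_eq_of_le (eLpNorm_congr_ae ?_) hle) hηε
  exact hm.coeFn_toLp.sub hf
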